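/- Let $n,N\in\mathbb N$, let $A\in\mathbb R^{n\times n}$, and let $w_0,\dots,w_{N-1}$ be i.i.d. random vectors with law $\mathcal N(0,I_n)$. Put $x_0=0$ and $x_{t+1}=Ax_t+w_t$, and let $X_-=[x_0,x_1,\dots,x_{N-1}]$ and $E=[w_0,\dots,w_{N-1}]$, both real $n\times N$ matrices. Let $\sigma_1(X_-)$ denote the largest singular value of $X_-$. Suppose that $L_{n,N}>0$ is a constant such that, almost surely, $\|X_-\|_F\le L_{n,N}\|E\|_F$, i.e. $$\sum_{i=0}^{N-1}\sum_{j=1}^{n}|\langle x_i,e_j\rangle|^2\le L_{n,N}^2\sum_{i=0}^{N-1}\sum_{j=1}^{n}|\langle w_i,e_j\rangle|^2 .$$ Then: 1. The map $E\mapsto\sigma_1(X_-)$, where $X_-=X_-(E)$ is obtained from an arbitrary deterministic noise matrix $E=[w_0,\dots,w_{N-1}]\in\mathbb R^{n\times N}$ by the recursion above, is $L_{n,N}$-Lipschitz from $\mathbb R^{n\times N}$ with the $\ell_2$ (Frobenius) metric to $\mathbb R$. 2. The random variable $\sigma_1(X_-)$ is integrable, and for every $\delta\in(0,1)$, $$\mathbb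 P\big(|\sigma_1(X_-)-\mathbb E\,\sigma_1(X_-)|\ge\sqrt2\,\delta\,L_{n,N}\big)\le 2e^{-\delta^2}.$$ -/

import Mathlib

open MeasureTheory ProbabilityTheory
open scoped NNReal

noncomputable section

/-- The state `x_t` of the linear system `x_{t+1} = A x_t + w_t`, started at `x_0 = 0` and driven by
the noise vectors `w_0, …, w_{N-1}`. (Beyond the horizon the noise is set to `0`; the states
`x_0, …, x_N` do not depend on this convention.) -/
def state {n N : ℕ} (A : Matrix (Fin n) (Fin n) ℝ) (w : Fin N → EuclideanSpace ℝ (Fin n)) :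
    ℕ → EuclideanSpace ℝ (Fin n)
  | 0 => 0
  | t + 1 => Matrix.toEuclideanLin A (state A w t) + (if h : t < N then w ⟨t, h⟩ else 0)

/-- The `n × N` data matrix `X₋ = [x_0, …, x_{N-1}]`, whose columns are the states. -/
def dataMatrix {n N : ℕ} (A : Matrix (Fin n) (Fin n) ℝ) (w : Fin N → EuclideanSpace ℝ (Fin n)) :
    Matrix (Fin n) (Fin N) ℝ :=
  Matrix.of fun j i => state A w i j

/-- The largest singular value `σ₁(M)` (Mathlib numbers the singular values from `0`). -/
def sigmaOne {m k : ℕ} (M : Matrix (Fin m) (Fin k) ℝ) : ℝ :=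
  (Matrix.toEuclideanLin M).singularValues 0

/-- `N`-tuples of vectors of `ℝⁿ` with the `ℓ₂` metric `√(∑ᵢ ‖vᵢ - wᵢ‖²)`, i.e. `n × N` noise
matrices with the Frobenius metric. -/
abbrev NoiseSpace (n N : ℕ) : Type :=
  PiLp 2 (fun _ : Fin N => EuclideanSpace ℝ (Fin n))

end

/-!
The argument rests on sharp Gaussian concentration: an `L`-Lipschitz function `f` of a standard
Gaussian vector of a finite-dimensional Euclidean space satisfies
`𝔼 exp (t (f - 𝔼 f)) ≤ exp (t² L² / 2)` (`LipschitzWith.hasSubgaussianMGF_stdGaussian`).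

It is proved by following the Gaussian convolution semigroup in short time steps, a discrete form
of Itô calculus.
* If the derivative of `g` is bounded by `L` and `K`-Lipschitz, a second-order expansion gives
  `𝔼 exp (g (x + s X) - 𝔼 g (x + s X)) ≤ exp (s² L² / 2 + C s³)` for `0 ≤ s ≤ 1`, where `C` depends
  only on `L`, `K` and the space (`exists_integral_exp_sub_integral_le`). The coefficient of `s²` is
  dimension-free because only the linear part of `g` at `x` contributes to it, and a linear
  functional `l` of `X` has variance `‖l‖²`.
* Averaging over translations preserves the class of such functions
  (`HasLipschitzFDeriv.integral_comp_add`), so exponential moments are submultiplicative along the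
  semigroup (`lintegral_exp_sub_integral_heatMeasure_le`). With `m` steps of length `1 / m` the
  total bound is `exp (L² / 2 + C / √m)`, and `m → ∞` removes the error.
* A Lipschitz function is a uniform limit of functions of this class with the same Lipschitz
  constant (`LipschitzWith.exists_hasLipschitzFDeriv`).

For the data matrix, the noise vectors together form a standard Gaussian vector of the noise space
(`map_toLp_eq_stdGaussian`). This measure has full support, so the almost sure Frobenius bound holds
for every noise matrix by continuity. Since the data matrix is linear in the noise and `σ₁` is the
operator norm, hence `1`-Lipschitz for the Frobenius norm (`abs_sigmaOne_sub_le`), `σ₁` is an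
`L`-Lipschitz function of the noise, and the concentration inequality applies with
deviation `√2 δ L`.
-/


/-! ### Functions with bounded and Lipschitz derivative -/

/-- `g` is differentiable, its derivative is bounded by `L` and is `K`-Lipschitz. -/
structure HasLipschitzFDeriv {E : Type*} [NormedAddCommGroup E] [NormedSpace ℝ E]
    (L K : ℝ) (g : E → ℝ) : Prop where
  differentiable : Differentiable ℝ g
  norm_fderiv_le : ∀ x, ‖fderiv ℝ g x‖ ≤ L
  norm_fderiv_sub_le : ∀ x y, ‖fderiv ℝ g x - fderiv ℝ g y‖ ≤ K * ‖x - y‖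

namespace HasLipschitzFDeriv

variable {E : Type*} [NormedAddCommGroup E] [NormedSpace ℝ E] {L K : ℝ} {g : E → ℝ}

lemma nonneg (h : HasLipschitzFDeriv L K g) : 0 ≤ L := (norm_nonneg _).trans (h.norm_fderiv_le 0)

lemma abs_sub_le (h : HasLipschitzFDeriv L K g) (x y : E) : |g x - g y| ≤ L * ‖x - y‖ :=
  Convex.norm_image_sub_le_of_norm_fderiv_le (𝕜 := ℝ) (fun z _ => h.differentiable z)
    (fun z _ => h.norm_fderiv_le z) convex_univ (Set.mem_univ _) (Set.mem_univ _)

/-- First-order Taylor bound; the constant is not optimal, as `K / 2` would do. -/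
lemma abs_sub_sub_le (h : HasLipschitzFDeriv L K g) (hK : 0 ≤ K) (x v : E) :
    |g (x + v) - g x - fderiv ℝ g x v| ≤ K * ‖v‖ ^ 2 := by
  have key := Convex.norm_image_sub_le_of_norm_fderiv_le' (𝕜 := ℝ) (f := g)
    (s := segment ℝ x (x + v)) (φ := fderiv ℝ g x) (C := K * ‖v‖) (x := x) (y := x + v)
    (fun z _ => h.differentiable z) (fun z hz => ?_) (convex_segment _ _)
    (left_mem_segment _ _ _) (right_mem_segment _ _ _)
  · simpa [pow_two, mul_assoc] using key
  · refine (h.norm_fderiv_sub_le z x).trans ?_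
    gcongr
    simpa using norm_sub_le_of_mem_segment hz

lemma continuous_fderiv (h : HasLipschitzFDeriv L K g) (hK : 0 ≤ K) :
    Continuous (fderiv ℝ g) :=
  (LipschitzWith.of_dist_le_mul (K := K.toNNReal) fun x y => by
    simpa [dist_eq_norm, hK] using h.norm_fderiv_sub_le x y).continuous

lemma const_mul (h : HasLipschitzFDeriv L K g) (c : ℝ) :
    HasLipschitzFDeriv (|c| * L) (|c| * K) (fun x => c * g x) := by
  have hf : ∀ x, fderiv ℝ (fun x => c * g x) x = c • fderiv ℝ g x := fun x =>
    fderiv_const_mul (h.differentiable x) c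
  refine ⟨h.differentiable.const_mul c, fun x => ?_, fun x y => ?_⟩
  · rw [hf, norm_smul, Real.norm_eq_abs]
    gcongr
    exact h.norm_fderiv_le x
  · rw [hf, hf, ← smul_sub, norm_smul, Real.norm_eq_abs, mul_assoc]
    gcongr
    exact h.norm_fderiv_sub_le x y

variable [MeasurableSpace E] [BorelSpace E]

lemma integrable_comp_add (h : HasLipschitzFDeriv L K g) {μ : Measure E}
    [IsFiniteMeasure μ] (hμ : Integrable id μ) (x : E) : Integrable (fun y => g (x + y)) μ := by
  have hc : Continuous fun y => g (x + y) := h.differentiable.continuous.comp (by fun_prop)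
  refine ((integrable_const (|g x|)).add (hμ.norm.const_mul L)).mono' hc.aestronglyMeasurable
    (.of_forall fun y => ?_)
  have h1 := h.abs_sub_le (x + y) x
  have h2 := abs_sub_abs_le_abs_sub (g (x + y)) (g x)
  simp only [add_sub_cancel_left, Real.norm_eq_abs, id, Pi.add_apply] at *
  linarith

/-- Averaging over translations preserves the bounds on the derivative. -/
lemma integral_comp_add [FiniteDimensional ℝ E] (h : HasLipschitzFDeriv L K g) (hK : 0 ≤ K)
    {μ : Measure E} [IsProbabilityMeasure μ] (hμ : Integrable id μ) :
    HasLipschitzFDeriv L K (fun x => ∫ y, g (x + y) ∂μ) := by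
  have hcont := h.continuous_fderiv hK
  have hmeas : ∀ x, AEStronglyMeasurable (fun y => fderiv ℝ g (x + y)) μ := fun x =>
    (hcont.comp (by fun_prop : Continuous fun y => x + y)).aestronglyMeasurable
  have hint : ∀ x, Integrable (fun y => fderiv ℝ g (x + y)) μ := fun x =>
    (integrable_const L).mono' (hmeas x) (.of_forall fun y => h.norm_fderiv_le _)
  have hd : ∀ x, HasFDerivAt (fun x => ∫ y, g (x + y) ∂μ) (∫ y, fderiv ℝ g (x + y) ∂μ) x := by
    intro x
    refine hasFDerivAt_integral_of_dominated_of_fderiv_le (bound := fun _ => L)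
      (F' := fun x y => fderiv ℝ g (x + y)) Filter.univ_mem
      (.of_forall fun z => (h.integrable_comp_add hμ z).aestronglyMeasurable)
      (h.integrable_comp_add hμ x) (hmeas x) (.of_forall fun y z _ => h.norm_fderiv_le _)
      (integrable_const L) (.of_forall fun y z _ => ?_)
    exact (hasFDerivAt_comp_add_right y).2 (h.differentiable (z + y)).hasFDerivAt
  refine ⟨fun x => (hd x).differentiableAt, fun x => ?_, fun x y => ?_⟩
  · rw [(hd x).fderiv]
    simpa using norm_integral_le_of_norm_le_const (μ := μ) (C := L)
      (.of_forall fun y => h.norm_fderiv_le (x + y))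
  · rw [(hd x).fderiv, (hd y).fderiv, ← integral_sub (hint x) (hint y)]
    simpa using norm_integral_le_of_norm_le_const (μ := μ) (C := K * ‖x - y‖)
      (.of_forall fun z => by simpa using h.norm_fderiv_sub_le (x + z) (y + z))

end HasLipschitzFDeriv

/-- Convolution with a smooth bump approximates a Lipschitz function uniformly by functions with
the same Lipschitz constant and with Lipschitz derivative. -/
lemma LipschitzWith.exists_hasLipschitzFDeriv {E : Type*} [NormedAddCommGroup E]
    [InnerProductSpace ℝ E] [FiniteDimensional ℝ E] [MeasurableSpace E] [BorelSpace E]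
    {L : ℝ≥0} {f : E → ℝ} (hf : LipschitzWith L f) {δ : ℝ} (hδ : 0 < δ) :
    ∃ (K : ℝ) (g : E → ℝ), 0 ≤ K ∧ HasLipschitzFDeriv L K g ∧ ∀ x, |g x - f x| ≤ L * δ := by
  let φ : ContDiffBump (0 : E) := ⟨δ / 2, δ, by positivity, by linarith⟩
  let μ : Measure E := volume
  let ψ : E → ℝ := φ.normed μ
  let g : E → ℝ := MeasureTheory.convolution ψ f (ContinuousLinearMap.lsmul ℝ ℝ) μ
  have hψc : HasCompactSupport ψ := φ.hasCompactSupport_normed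
  have hψs : ContDiff ℝ 1 ψ := φ.contDiff_normed
  have hψ0 : ∀ x, 0 ≤ ψ x := φ.nonneg_normed
  have hψ1 : ∫ x, ψ x ∂μ = 1 := φ.integral_normed
  have hψi : Integrable ψ μ := hψs.continuous.integrable_of_hasCompactSupport hψc
  have hfl : LocallyIntegrable f μ := hf.continuous.locallyIntegrable
  have hdc : HasCompactSupport (fderiv ℝ ψ) := hψc.fderiv ℝ
  have hdcont : Continuous (fderiv ℝ ψ) := hψs.continuous_fderiv one_ne_zero
  have hdi : Integrable (fderiv ℝ ψ) μ := hdcont.integrable_of_hasCompactSupport hdc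
  have hder : ∀ x, HasFDerivAt g (∫ y, f (x - y) • fderiv ℝ ψ y ∂μ) x := by
    intro x
    have e : ∫ y, f (x - y) • fderiv ℝ ψ y ∂μ = MeasureTheory.convolution (fderiv ℝ ψ) f
        (ContinuousLinearMap.precompL E (ContinuousLinearMap.lsmul ℝ ℝ)) μ x := by
      refine integral_congr_ae (.of_forall fun y => ?_)
      ext v
      simp [ContinuousLinearMap.precompL, mul_comm]
    rw [e]
    exact hψc.hasFDerivAt_convolution_left (ContinuousLinearMap.lsmul ℝ ℝ) hψs hfl x
  have hgi : ∀ x, Integrable (fun y => ψ y * f (x - y)) μ := by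
    intro x
    have hc : Continuous fun y => f (x - y) := hf.continuous.comp (by fun_prop)
    exact (hψs.continuous.mul hc).integrable_of_hasCompactSupport hψc.mul_right
  have hgi' : ∀ x, Integrable (fun y => f (x - y) • fderiv ℝ ψ y) μ := by
    intro x
    have hc : Continuous fun y => f (x - y) := hf.continuous.comp (by fun_prop)
    exact (hc.smul hdcont).integrable_of_hasCompactSupport
      (HasCompactSupport.smul_left (f := fun y => f (x - y)) hdc)
  have hlip : LipschitzWith L g := by
    refine LipschitzWith.of_dist_le_mul fun x y => ?_
    have hg : ∀ z, g z = ∫ u, ψ u * f (z - u) ∂μ := fun z => by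
      simp [g, MeasureTheory.convolution]
    rw [Real.dist_eq, hg, hg, ← integral_sub (hgi x) (hgi y)]
    have : ∀ u, ‖ψ u * f (x - u) - ψ u * f (y - u)‖ ≤ ψ u * (L * dist x y) := by
      intro u
      rw [← mul_sub, norm_mul, Real.norm_of_nonneg (hψ0 u)]
      gcongr
      · exact hψ0 u
      · simpa [Real.dist_eq] using hf.dist_le_mul (x - u) (y - u)
    refine (norm_integral_le_of_norm_le (hψi.mul_const _) (.of_forall this)).trans_eq ?_
    rw [integral_mul_const, hψ1, one_mul]
  refine ⟨L * ∫ y, ‖fderiv ℝ ψ y‖ ∂μ, g, by positivity, ⟨fun x => (hder x).differentiableAt,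
    fun x => norm_fderiv_le_of_lipschitz ℝ hlip, fun x y => ?_⟩, fun x => ?_⟩
  · rw [(hder x).fderiv, (hder y).fderiv, ← integral_sub (hgi' x) (hgi' y)]
    have : ∀ u, ‖f (x - u) • fderiv ℝ ψ u - f (y - u) • fderiv ℝ ψ u‖ ≤
        (L * ‖x - y‖) * ‖fderiv ℝ ψ u‖ := by
      intro u
      rw [← sub_smul, norm_smul]
      gcongr
      simpa [Real.dist_eq, dist_eq_norm] using hf.dist_le_mul (x - u) (y - u)
    refine (norm_integral_le_of_norm_le (hdi.norm.const_mul _) (.of_forall this)).trans_eq ?_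
    rw [integral_const_mul]
    ring
  · refine ContDiffBump.dist_normed_convolution_le (φ := φ) hf.continuous.aestronglyMeasurable
      fun y hy => (hf.dist_le_mul y x).trans ?_
    gcongr
    exact (Metric.mem_ball.1 hy).le

/-! ### The Gaussian convolution semigroup -/

/-- The law of `√t • X` for `X` standard Gaussian, that is, the centred Gaussian measure with
covariance `t • 1`. -/
noncomputable def heatMeasure (E : Type*) [NormedAddCommGroup E] [InnerProductSpace ℝ E]
    [FiniteDimensional ℝ E] [MeasurableSpace E] (t : ℝ) : Measure E :=
  (stdGaussian E).map fun y => √t • y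

section GaussianSemigroup

variable {E : Type*} [NormedAddCommGroup E] [InnerProductSpace ℝ E] [FiniteDimensional ℝ E]
  [MeasurableSpace E]

lemma heatMeasure_one : heatMeasure E 1 = stdGaussian E := by
  simp [heatMeasure]

variable [BorelSpace E]

instance (t : ℝ) : IsProbabilityMeasure (heatMeasure E t) :=
  Measure.isProbabilityMeasure_map (by fun_prop)

lemma heatMeasure_zero : heatMeasure E 0 = Measure.dirac 0 := by
  simp [heatMeasure]

lemma integrable_id_heatMeasure (t : ℝ) : Integrable id (heatMeasure E t) := by
  rw [heatMeasure, integrable_map_measure (by fun_prop) (by fun_prop)]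
  exact (IsGaussian.integrable_id (μ := stdGaussian E)).smul (√t)

lemma charFun_heatMeasure {t : ℝ} (ht : 0 ≤ t) (u : E) :
    charFun (heatMeasure E t) u = Complex.exp (-(t * ‖u‖ ^ 2 : ℝ) / 2) := by
  rw [heatMeasure, charFun_map_smul, charFun_stdGaussian, norm_smul, Real.norm_eq_abs]
  congr 2
  norm_cast
  rw [mul_pow, sq_abs, Real.sq_sqrt ht]

lemma heatMeasure_conv {s t : ℝ} (hs : 0 ≤ s) (ht : 0 ≤ t) :
    heatMeasure E s ∗ heatMeasure E t = heatMeasure E (s + t) := by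
  apply Measure.ext_of_charFun
  ext u
  rw [charFun_conv, charFun_heatMeasure hs, charFun_heatMeasure ht,
    charFun_heatMeasure (add_nonneg hs ht), ← Complex.exp_add]
  congr 1
  push_cast
  ring

/-! ### The moment generating function over a short time -/

/-- All exponential moments of the norm are finite, by Fernique's theorem and completion of the
square. -/
lemma integrable_exp_mul_norm_stdGaussian (c : ℝ) :
    Integrable (fun y : E => Real.exp (c * ‖y‖)) (stdGaussian E) := by
  obtain ⟨C, hC, hi⟩ := IsGaussian.exists_integrable_exp_sq (stdGaussian E)
  refine (hi.const_mul (Real.exp (c ^ 2 / (4 * C)))).mono' (by fun_prop) (.of_forall fun y => ?_)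
  rw [Real.norm_of_nonneg (Real.exp_nonneg _), ← Real.exp_add]
  gcongr
  have h : c ^ 2 / (4 * C) + C * ‖y‖ ^ 2 - c * ‖y‖ = C * (‖y‖ - c / (2 * C)) ^ 2 := by
    field_simp
    ring
  have : 0 ≤ C * (‖y‖ - c / (2 * C)) ^ 2 := by positivity
  linarith

lemma exp_le_quadratic_add_cubic (y : ℝ) :
    Real.exp y ≤ 1 + y + y ^ 2 / 2 + |y| ^ 3 * Real.exp |y| := by
  have h := Complex.norm_exp_sub_sum_le_norm_mul_exp (y : ℂ) 3
  have e : Complex.exp y - ∑ m ∈ Finset.range 3, (y : ℂ) ^ m / (m.factorial : ℂ) =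
      ((Real.exp y - (1 + y + y ^ 2 / 2) : ℝ) : ℂ) := by
    simp [Finset.sum_range_succ, Nat.factorial]
  rw [e, Complex.norm_real, Complex.norm_real, Real.norm_eq_abs, Real.norm_eq_abs] at h
  linarith [le_abs_self (Real.exp y - (1 + y + y ^ 2 / 2))]

lemma integral_sq_strongDual_stdGaussian (l : StrongDual ℝ E) :
    ∫ y, l y ^ 2 ∂stdGaussian E = ‖l‖ ^ 2 := by
  rw [← variance_dual_stdGaussian l, variance_of_integral_eq_zero (by fun_prop)
    (integral_strongDual_stdGaussian l)]

/-- The mean minimizes the mean square distance. -/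
lemma integral_sub_integral_sq_le {Ω : Type*} [MeasurableSpace Ω] {μ : Measure Ω}
    [IsProbabilityMeasure μ] {h : Ω → ℝ} (hh : MemLp h 2 μ) (a : ℝ) :
    ∫ y, (h y - ∫ z, h z ∂μ) ^ 2 ∂μ ≤ ∫ y, (h y - a) ^ 2 ∂μ := by
  rw [← variance_eq_integral hh.aemeasurable, ← variance_sub_const hh.aestronglyMeasurable a]
  exact variance_le_expectation_sq (hh.aestronglyMeasurable.sub aestronglyMeasurable_const)

/-- Second-order expansion of the exponential moment of a centred `g (x + s X)`: only the linear
part of `g` at `x` contributes to the coefficient of `s ^ 2`, and it contributes at most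
`L ^ 2 / 2`. The error is uniform in `g` and `x`. -/
lemma exists_integral_exp_sub_integral_le (L K : ℝ) (hL : 0 ≤ L) (hK : 0 ≤ K) :
    ∃ C : ℝ, 0 ≤ C ∧ ∀ g : E → ℝ, HasLipschitzFDeriv L K g → ∀ (x : E) (s : ℝ), 0 ≤ s → s ≤ 1 →
      Integrable (fun y => Real.exp (g (x + s • y) - ∫ z, g (x + s • z) ∂stdGaussian E))
        (stdGaussian E) ∧
      ∫ y, Real.exp (g (x + s • y) - ∫ z, g (x + s • z) ∂stdGaussian E) ∂stdGaussian E ≤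
        Real.exp (s ^ 2 * L ^ 2 / 2 + C * s ^ 3) := by
  set γ := stdGaussian E
  set m : ℝ := ∫ z : E, ‖z‖ ∂γ with hm
  have hm0 : 0 ≤ m := by positivity
  have hn1 : Integrable (fun z : E => ‖z‖) γ := IsGaussian.integrable_id.norm
  have hpow : ∀ k : ℕ, k ≠ 0 → Integrable (fun z : E => ‖z‖ ^ k) γ := fun k hk =>
    (IsGaussian.memLp_id γ k (by simp)).integrable_norm_pow hk
  have hexp : Integrable (fun y : E => Real.exp (2 * (L * (‖y‖ + m)))) γ := by
    convert (integrable_exp_mul_norm_stdGaussian (E := E) (2 * L)).const_mul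
      (Real.exp (2 * L * m)) using 2 with y
    rw [← Real.exp_add]
    ring_nf
  set R : E → ℝ := fun y => 2 * L * K * ‖y‖ ^ 3 + K ^ 2 * ‖y‖ ^ 4 with hR
  have hRi : Integrable R γ := ((hpow 3 (by norm_num)).const_mul _).add
    ((hpow 4 (by norm_num)).const_mul _)
  refine ⟨(∫ y, R y ∂γ) / 2 + 6 * ∫ y : E, Real.exp (2 * (L * (‖y‖ + m))) ∂γ, by positivity, ?_⟩
  intro g hg x s hs0 hs1
  set h : E → ℝ := fun y => g (x + s • y) with hh
  have hcont : Continuous h := hg.differentiable.continuous.comp (by fun_prop)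
  have hlin : ∀ y z, |h y - h z| ≤ L * s * ‖y - z‖ := fun y z => by
    have := hg.abs_sub_le (x + s • y) (x + s • z)
    rwa [add_sub_add_left_eq_sub, ← smul_sub, norm_smul, Real.norm_of_nonneg hs0,
      ← mul_assoc] at this
  have hh2 : MemLp h 2 γ := by
    have h1 : MemLp (fun y => h y - h 0) 2 γ := by
      refine (((IsGaussian.memLp_two_id (μ := γ)).norm).const_mul (L * s)).mono'
        (by fun_prop) (.of_forall fun y => ?_)
      simpa using hlin y 0
    convert h1.add (memLp_const (h 0)) using 1
    ext y
    simp
  have hhi : Integrable h γ := hh2.integrable one_le_two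
  set b := ∫ z, h z ∂γ with hb
  set Y : E → ℝ := fun y => h y - b with hY
  have hYc : Continuous Y := by fun_prop
  have hY2 : MemLp Y 2 γ := hh2.sub (memLp_const b)
  have hYi : Integrable Y γ := hY2.integrable one_le_two
  have hY0 : ∫ y, Y y ∂γ = 0 := by simp [hY, integral_sub hhi (integrable_const b), ← hb]
  -- `Y y` is the average of `h y - h z` over `z`, so the Lipschitz bound gives a factor `s`
  have hYb : ∀ y, |Y y| ≤ s * (L * (‖y‖ + m)) := by
    intro y
    have e : Y y = ∫ z, (h y - h z) ∂γ := by
      simp [hY, integral_sub (integrable_const (h y)) hhi, ← hb]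
    have hbound : ∀ z : E, ‖h y - h z‖ ≤ L * s * (‖y‖ + ‖z‖) := fun z =>
      (hlin y z).trans (by gcongr; exact norm_sub_le y z)
    rw [e, ← Real.norm_eq_abs]
    have hsum : Integrable (fun z : E => ‖y‖ + ‖z‖) γ := (integrable_const ‖y‖).add hn1
    refine (norm_integral_le_of_norm_le (hsum.const_mul (L * s)) (.of_forall hbound)).trans_eq ?_
    rw [integral_const_mul, integral_add (integrable_const _) hn1]
    simp [← hm]
    ring
  -- the cubic remainder of the exponential is `O(s ^ 3)`, uniformly in `g` and `x`
  have hcub : ∀ y, |Y y| ^ 3 * Real.exp |Y y| ≤ s ^ 3 * (6 * Real.exp (2 * (L * (‖y‖ + m)))) := by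
    intro y
    set u := L * (‖y‖ + m)
    have hu0 : 0 ≤ u := by positivity
    have h1 : |Y y| ≤ u := (hYb y).trans (mul_le_of_le_one_left hu0 hs1)
    have h2 : u ^ 3 ≤ 6 * Real.exp u := by
      have := Real.pow_div_factorial_le_exp u hu0 3
      norm_num [Nat.factorial] at this
      linarith
    calc |Y y| ^ 3 * Real.exp |Y y| ≤ (s * u) ^ 3 * Real.exp u := by
          gcongr
          exact hYb y
      _ = s ^ 3 * (u ^ 3 * Real.exp u) := by ring
      _ ≤ s ^ 3 * (6 * Real.exp u * Real.exp u) := by gcongr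
      _ = s ^ 3 * (6 * Real.exp (2 * u)) := by rw [two_mul u, Real.exp_add]; ring
  have hY2i : Integrable (fun y => Y y ^ 2) γ := hY2.integrable_sq
  have hexpi : Integrable (fun y => Real.exp (Y y)) γ := by
    refine hexp.mono' (by fun_prop) (.of_forall fun y => ?_)
    rw [Real.norm_of_nonneg (Real.exp_nonneg _)]
    gcongr
    have hu0 : 0 ≤ L * (‖y‖ + m) := by positivity
    have h1 : |Y y| ≤ L * (‖y‖ + m) := (hYb y).trans (mul_le_of_le_one_left hu0 hs1)
    linarith [le_abs_self (Y y)]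
  refine ⟨hexpi, ?_⟩
  set l := fderiv ℝ g x with hl
  have hli : Integrable (fun y => l y ^ 2) γ :=
    MemLp.integrable_sq (IsGaussian.memLp_dual γ l 2 (by simp))
  have hsq : ∀ y, (h y - g x) ^ 2 ≤ s ^ 2 * l y ^ 2 + s ^ 3 * R y := by
    intro y
    have h1 := hg.abs_sub_sub_le hK x (s • y)
    rw [norm_smul, Real.norm_of_nonneg hs0, map_smul, smul_eq_mul] at h1
    have h2 : |l y| ≤ L * ‖y‖ := l.le_of_opNorm_le (hg.norm_fderiv_le x) y
    set r := g (x + s • y) - g x - s * l y with hr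
    have e : h y - g x = s * l y + r := by simp [hr, hh]
    have h3 : s * l y * r ≤ s ^ 3 * (L * K * ‖y‖ ^ 3) := by
      calc s * l y * r ≤ |s * l y * r| := le_abs_self _
        _ = s * |l y| * |r| := by rw [abs_mul, abs_mul, abs_of_nonneg hs0]
        _ ≤ s * (L * ‖y‖) * (K * (s * ‖y‖) ^ 2) := by gcongr
        _ = _ := by ring
    have h4 : r ^ 2 ≤ s ^ 3 * (K ^ 2 * ‖y‖ ^ 4) := by
      calc r ^ 2 = |r| ^ 2 := (sq_abs r).symm
        _ ≤ (K * (s * ‖y‖) ^ 2) ^ 2 := by gcongr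
        _ = s ^ 4 * (K ^ 2 * ‖y‖ ^ 4) := by ring
        _ ≤ s ^ 3 * (K ^ 2 * ‖y‖ ^ 4) := by
          gcongr ?_ * _
          exact pow_le_pow_of_le_one hs0 hs1 (by norm_num)
    rw [e, hR]
    nlinarith
  -- the mean of `h` is replaced by the constant `g x`, about which the Taylor expansion applies
  have hvar : ∫ y, Y y ^ 2 ∂γ ≤ s ^ 2 * L ^ 2 + s ^ 3 * ∫ y, R y ∂γ := by
    calc ∫ y, Y y ^ 2 ∂γ ≤ ∫ y, (h y - g x) ^ 2 ∂γ := integral_sub_integral_sq_le hh2 (g x)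
      _ ≤ ∫ y, (s ^ 2 * l y ^ 2 + s ^ 3 * R y) ∂γ :=
        integral_mono (hh2.sub (memLp_const (g x))).integrable_sq
          ((hli.const_mul _).add (hRi.const_mul _)) hsq
      _ = s ^ 2 * ‖l‖ ^ 2 + s ^ 3 * ∫ y, R y ∂γ := by
        rw [integral_add (hli.const_mul _) (hRi.const_mul _), integral_const_mul,
          integral_const_mul, integral_sq_strongDual_stdGaussian]
      _ ≤ _ := by
        gcongr
        exact hg.norm_fderiv_le x
  have i1 : Integrable (fun y => 1 + Y y) γ := (integrable_const 1).add hYi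
  have i2 : Integrable (fun y => 1 + Y y + Y y ^ 2 / 2) γ := i1.add (hY2i.div_const 2)
  have i3 : Integrable (fun y : E => s ^ 3 * (6 * Real.exp (2 * (L * (‖y‖ + m))))) γ :=
    (hexp.const_mul 6).const_mul _
  calc ∫ y, Real.exp (Y y) ∂γ
      ≤ ∫ y, (1 + Y y + Y y ^ 2 / 2 + s ^ 3 * (6 * Real.exp (2 * (L * (‖y‖ + m))))) ∂γ :=
        integral_mono hexpi (i2.add i3) fun y =>
          (exp_le_quadratic_add_cubic (Y y)).trans (by linarith [hcub y])
    _ = 1 + (∫ y, Y y ^ 2 ∂γ) / 2 + s ^ 3 * (6 * ∫ y : E, Real.exp (2 * (L * (‖y‖ + m))) ∂γ) := by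
        rw [integral_add i2 i3, integral_add i1 (hY2i.div_const 2),
          integral_add (integrable_const 1) hYi, hY0, integral_div, integral_const_mul,
          integral_const_mul]
        simp
    _ ≤ (s ^ 2 * L ^ 2 / 2 + ((∫ y, R y ∂γ) / 2 +
          6 * ∫ y : E, Real.exp (2 * (L * (‖y‖ + m))) ∂γ) * s ^ 3) + 1 := by linarith
    _ ≤ _ := Real.add_one_le_exp _

end GaussianSemigroup

/-! ### Sharp Gaussian concentration for Lipschitz functions -/

section Concentration

variable {E : Type*} [NormedAddCommGroup E] [InnerProductSpace ℝ E] [FiniteDimensional ℝ E]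
  [MeasurableSpace E] [BorelSpace E]

/-- Exponential moments of centred functions are submultiplicative along the Gaussian semigroup:
`k` steps of length `t` cost at most the `k`-th power of a bound valid for one step. -/
lemma lintegral_exp_sub_integral_heatMeasure_le {L K t : ℝ} (hK : 0 ≤ K) (ht : 0 ≤ t)
    {B : ENNReal}
    (hB : ∀ g : E → ℝ, HasLipschitzFDeriv L K g → ∀ x,
      ∫⁻ y, ENNReal.ofReal (Real.exp (g (x + y) - ∫ z, g (x + z) ∂heatMeasure E t))
        ∂heatMeasure E t ≤ B) (k : ℕ) :
    ∀ g : E → ℝ, HasLipschitzFDeriv L K g → ∀ x,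
      ∫⁻ y, ENNReal.ofReal (Real.exp (g (x + y) - ∫ z, g (x + z) ∂heatMeasure E (k * t)))
        ∂heatMeasure E (k * t) ≤ B ^ k := by
  induction k with
  | zero =>
    intro g hg x
    simp [heatMeasure_zero]
  | succ k ih =>
    intro g hg x
    have hconv : heatMeasure E ((k + 1 : ℕ) * t) = heatMeasure E (k * t) ∗ heatMeasure E t := by
      rw [heatMeasure_conv (by positivity) ht]
      push_cast
      ring_nf
    set gt : E → ℝ := fun x => ∫ y, g (x + y) ∂heatMeasure E t with hgt
    have hgt' : HasLipschitzFDeriv L K gt := hg.integral_comp_add hK (integrable_id_heatMeasure t)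
    have hmean : ∫ z, g (x + z) ∂heatMeasure E ((k + 1 : ℕ) * t) =
        ∫ y, gt (x + y) ∂heatMeasure E (k * t) := by
      have hi := hg.integrable_comp_add (integrable_id_heatMeasure ((k + 1 : ℕ) * t)) x
      rw [hconv] at hi ⊢
      rw [integral_conv hi]
      simp [hgt, add_assoc]
    rw [hmean, hconv]
    set c := ∫ y, gt (x + y) ∂heatMeasure E (k * t)
    have hgc := hg.differentiable.continuous
    have hgtc := hgt'.differentiable.continuous
    rw [Measure.lintegral_conv (by fun_prop)]
    calc ∫⁻ y, ∫⁻ z, ENNReal.ofReal (Real.exp (g (x + (y + z)) - c)) ∂heatMeasure E t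
          ∂heatMeasure E (k * t)
        = ∫⁻ y, ENNReal.ofReal (Real.exp (gt (x + y) - c)) *
            ∫⁻ z, ENNReal.ofReal (Real.exp (g (x + y + z) - gt (x + y))) ∂heatMeasure E t
          ∂heatMeasure E (k * t) := by
          refine lintegral_congr fun y => ?_
          rw [← lintegral_const_mul _ (by fun_prop)]
          refine lintegral_congr fun z => ?_
          rw [← ENNReal.ofReal_mul (Real.exp_nonneg _), ← Real.exp_add, add_assoc]
          congr 2
          ring
      _ ≤ ∫⁻ y, ENNReal.ofReal (Real.exp (gt (x + y) - c)) * B ∂heatMeasure E (k * t) := by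
          refine lintegral_mono fun y => ?_
          gcongr
          exact hB g hg (x + y)
      _ = (∫⁻ y, ENNReal.ofReal (Real.exp (gt (x + y) - c)) ∂heatMeasure E (k * t)) * B :=
          lintegral_mul_const _ (by fun_prop)
      _ ≤ B ^ k * B := by
          gcongr
          exact ih gt hgt' x
      _ = B ^ (k + 1) := (pow_succ B k).symm

lemma LipschitzWith.integrable_exp_mul_stdGaussian {L : ℝ≥0} {f : E → ℝ} (hf : LipschitzWith L f)
    (t : ℝ) : Integrable (fun y => Real.exp (t * f y)) (stdGaussian E) := by
  have hc := hf.continuous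
  refine ((integrable_exp_mul_norm_stdGaussian (E := E) (|t| * L)).const_mul
    (Real.exp (|t| * |f 0|))).mono' (by fun_prop) (.of_forall fun y => ?_)
  rw [Real.norm_of_nonneg (Real.exp_nonneg _), ← Real.exp_add]
  gcongr
  have h1 : |f y - f 0| ≤ L * ‖y‖ := by simpa [Real.dist_eq] using hf.dist_le_mul y 0
  have h2 : |f y| ≤ |f 0| + L * ‖y‖ := by linarith [abs_sub_abs_le_abs_sub (f y) (f 0)]
  calc t * f y ≤ |t| * |f y| := by rw [← abs_mul]; exact le_abs_self _
    _ ≤ |t| * (|f 0| + L * ‖y‖) := by gcongr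
    _ = _ := by ring

lemma LipschitzWith.integrable_stdGaussian {L : ℝ≥0} {f : E → ℝ} (hf : LipschitzWith L f) :
    Integrable f (stdGaussian E) := by
  have hc := hf.continuous
  refine ((integrable_const (|f 0|)).add
    ((IsGaussian.integrable_id (μ := stdGaussian E)).norm.const_mul (L : ℝ))).mono'
    hc.aestronglyMeasurable (.of_forall fun y => ?_)
  have h1 : |f y - f 0| ≤ L * ‖y‖ := by simpa [Real.dist_eq] using hf.dist_le_mul y 0
  simp only [Real.norm_eq_abs, Pi.add_apply, id]
  linarith [abs_sub_abs_le_abs_sub (f y) (f 0)]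

/-- The sharp exponential moment bound for functions with Lipschitz derivative. Cutting the unit
time interval into `m` steps gives the bound `exp (L ^ 2 / 2 + C / √m)`, and `m` tends to
infinity. -/
lemma HasLipschitzFDeriv.integral_exp_sub_integral_le {L K : ℝ} (hK : 0 ≤ K) {g : E → ℝ}
    (hg : HasLipschitzFDeriv L K g) :
    ∫ y, Real.exp (g y - ∫ z, g z ∂stdGaussian E) ∂stdGaussian E ≤ Real.exp (L ^ 2 / 2) := by
  obtain ⟨C, hC, hstep⟩ := exists_integral_exp_sub_integral_le (E := E) L K hg.nonneg hK
  have hbound : ∀ m : ℕ, 0 < m → ∫⁻ y, ENNReal.ofReal (Real.exp (g y - ∫ z, g z ∂stdGaussian E))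
      ∂stdGaussian E ≤ ENNReal.ofReal (Real.exp (L ^ 2 / 2 + C * √(1 / m))) := by
    intro m hm
    have hm' : (0 : ℝ) < m := by exact_mod_cast hm
    have ht : (0 : ℝ) ≤ 1 / m := by positivity
    set s : ℝ := √(1 / m) with hs
    have hs0 : 0 ≤ s := Real.sqrt_nonneg _
    have hs2 : s ^ 2 = 1 / m := Real.sq_sqrt ht
    have hs1 : s ≤ 1 := Real.sqrt_le_one.2 (by
      rw [div_le_one hm']
      exact_mod_cast hm)
    have hB : ∀ g : E → ℝ, HasLipschitzFDeriv L K g → ∀ x,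
        ∫⁻ y, ENNReal.ofReal (Real.exp (g (x + y) - ∫ z, g (x + z) ∂heatMeasure E (1 / m)))
        ∂heatMeasure E (1 / m) ≤ ENNReal.ofReal (Real.exp (s ^ 2 * L ^ 2 / 2 + C * s ^ 3)) := by
      intro g hg x
      have hgc := hg.differentiable.continuous
      obtain ⟨h1, h2⟩ := hstep g hg x s hs0 hs1
      rw [heatMeasure, ← hs, integral_map (by fun_prop)
        (by exact Continuous.aestronglyMeasurable (by fun_prop)),
        lintegral_map (by fun_prop) (by fun_prop),
        ← ofReal_integral_eq_lintegral_ofReal h1 (.of_forall fun _ => Real.exp_nonneg _)]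
      exact ENNReal.ofReal_le_ofReal h2
    have h := lintegral_exp_sub_integral_heatMeasure_le hK ht hB m g hg 0
    rw [mul_one_div_cancel hm'.ne', heatMeasure_one] at h
    simp only [zero_add] at h
    refine h.trans_eq ?_
    rw [← ENNReal.ofReal_pow (Real.exp_nonneg _), ← Real.exp_nat_mul]
    congr 2
    have : (m : ℝ) * s ^ 2 = 1 := by rw [hs2, mul_one_div_cancel hm'.ne']
    calc (m : ℝ) * (s ^ 2 * L ^ 2 / 2 + C * s ^ 3)
        = (m * s ^ 2) * (L ^ 2 / 2 + C * s) := by ring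
      _ = _ := by rw [this, one_mul]
  have hgL : LipschitzWith L.toNNReal g := LipschitzWith.of_dist_le_mul fun x y => by
    simpa [Real.dist_eq, dist_eq_norm, hg.nonneg] using hg.abs_sub_le x y
  have hint : Integrable (fun y => Real.exp (g y - ∫ z, g z ∂stdGaussian E)) (stdGaussian E) := by
    simpa [Real.exp_sub] using (hgL.integrable_exp_mul_stdGaussian 1).div_const _
  have hlim : Filter.Tendsto (fun m : ℕ => Real.exp (L ^ 2 / 2 + C * √(1 / m))) Filter.atTop
      (nhds (Real.exp (L ^ 2 / 2))) := by
    have h1 : Filter.Tendsto (fun m : ℕ => √(1 / (m : ℝ))) Filter.atTop (nhds 0) := by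
      simpa only [Real.sqrt_zero, Function.comp_def] using
        (Real.continuous_sqrt.tendsto 0).comp tendsto_one_div_atTop_nhds_zero_nat
    have h2 : Continuous fun u : ℝ => Real.exp (L ^ 2 / 2 + C * u) := by fun_prop
    simpa only [mul_zero, add_zero, Function.comp_def] using (h2.tendsto 0).comp h1
  refine ge_of_tendsto hlim ((Filter.eventually_gt_atTop 0).mono fun m hm => ?_)
  have := hbound m hm
  rwa [← ofReal_integral_eq_lintegral_ofReal hint (.of_forall fun _ => Real.exp_nonneg _),
    ENNReal.ofReal_le_ofReal_iff (Real.exp_nonneg _)] at this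

/-- **Gaussian concentration**: an `L`-Lipschitz function of a standard Gaussian vector is
sub-Gaussian around its mean, with variance proxy `L ^ 2`. -/
theorem LipschitzWith.hasSubgaussianMGF_stdGaussian {L : ℝ≥0} {f : E → ℝ}
    (hf : LipschitzWith L f) :
    HasSubgaussianMGF (fun x => f x - ∫ z, f z ∂stdGaussian E) (L ^ 2) (stdGaussian E) := by
  have hexp : ∀ t : ℝ, Integrable (fun y => Real.exp (t * (f y - ∫ z, f z ∂stdGaussian E)))
      (stdGaussian E) := fun t => by
    simpa [mul_sub, Real.exp_sub] using (hf.integrable_exp_mul_stdGaussian t).div_const _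
  refine ⟨hexp, fun t => ?_⟩
  have hfi := hf.integrable_stdGaussian
  -- `t • f` and `t • g` differ by at most `|t| L δ`, and so do their means, which accounts for
  -- the factor `2`
  have happrox : ∀ δ : ℝ, 0 < δ → mgf (fun x => f x - ∫ z, f z ∂stdGaussian E) (stdGaussian E) t ≤
      Real.exp ((|t| * L) ^ 2 / 2 + |t| * (2 * L * δ)) := by
    intro δ hδ
    obtain ⟨K, g, hK, hg, hgf⟩ := hf.exists_hasLipschitzFDeriv hδ
    have htg := hg.const_mul t
    have hgL : LipschitzWith L g := LipschitzWith.of_dist_le_mul fun x y => by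
      simpa [Real.dist_eq, dist_eq_norm] using hg.abs_sub_le x y
    have hgi := hgL.integrable_stdGaussian
    have hmean : |∫ z, g z ∂stdGaussian E - ∫ z, f z ∂stdGaussian E| ≤ L * δ := by
      rw [← integral_sub hgi hfi]
      simpa using norm_integral_le_of_norm_le_const (μ := stdGaussian E)
        (f := fun z => g z - f z) (C := L * δ) (.of_forall hgf)
    have hpt : ∀ y, t * (f y - ∫ z, f z ∂stdGaussian E) ≤
        |t| * (2 * L * δ) + (t * g y - ∫ z, t * g z ∂stdGaussian E) := by
      intro y
      rw [integral_const_mul]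
      set a := ∫ z, g z ∂stdGaussian E - ∫ z, f z ∂stdGaussian E with ha
      have h1 : t * (a - (g y - f y)) ≤ |t| * (2 * L * δ) := by
        refine (le_abs_self _).trans ?_
        rw [abs_mul]
        gcongr
        linarith [abs_sub a (g y - f y), hgf y]
      have h2 : t * (f y - ∫ z, f z ∂stdGaussian E) = t * (a - (g y - f y)) +
        (t * g y - t * ∫ z, g z ∂stdGaussian E) := by rw [ha]; ring
      linarith
    have hgexp : Integrable (fun y => Real.exp (t * g y - ∫ z, t * g z ∂stdGaussian E))
        (stdGaussian E) := by
      simpa [Real.exp_sub] using (hgL.integrable_exp_mul_stdGaussian t).div_const _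
    calc mgf (fun x => f x - ∫ z, f z ∂stdGaussian E) (stdGaussian E) t
        ≤ ∫ y, Real.exp (|t| * (2 * L * δ)) *
            Real.exp (t * g y - ∫ z, t * g z ∂stdGaussian E) ∂stdGaussian E := by
          refine integral_mono (hexp t) (hgexp.const_mul _) fun y => ?_
          simp only [← Real.exp_add]
          exact Real.exp_le_exp.2 (hpt y)
      _ ≤ Real.exp (|t| * (2 * L * δ)) * Real.exp ((|t| * L) ^ 2 / 2) := by
          rw [integral_const_mul]
          gcongr
          exact htg.integral_exp_sub_integral_le (by positivity)
      _ = _ := by rw [← Real.exp_add, add_comm]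
  have hlim : Filter.Tendsto (fun δ : ℝ => Real.exp ((|t| * L) ^ 2 / 2 + |t| * (2 * L * δ)))
      (nhdsWithin 0 (Set.Ioi 0)) (nhds (Real.exp ((|t| * L) ^ 2 / 2))) := by
    have h2 : Continuous fun δ : ℝ => Real.exp ((|t| * L) ^ 2 / 2 + |t| * (2 * L * δ)) := by
      fun_prop
    simpa using (h2.tendsto 0).mono_left nhdsWithin_le_nhds
  refine (ge_of_tendsto hlim (Filter.eventually_of_mem self_mem_nhdsWithin happrox)).trans_eq ?_
  rw [mul_pow, sq_abs]
  push_cast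
  ring_nf

/-- Two-sided tail bound for a Lipschitz function of a standard Gaussian vector. -/
theorem LipschitzWith.measure_abs_sub_integral_ge_le_stdGaussian {L : ℝ≥0} {f : E → ℝ}
    (hf : LipschitzWith L f) {r : ℝ} (hr : 0 ≤ r) :
    (stdGaussian E).real {x | r ≤ |f x - ∫ z, f z ∂stdGaussian E|} ≤
      2 * Real.exp (-r ^ 2 / (2 * (L : ℝ) ^ 2)) := by
  have h := hf.hasSubgaussianMGF_stdGaussian
  have h1 := h.measure_ge_le hr
  have h2 := h.neg.measure_ge_le hr
  have hsub : {x | r ≤ |f x - ∫ z, f z ∂stdGaussian E|} ⊆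
      {x | r ≤ f x - ∫ z, f z ∂stdGaussian E} ∪
        {x | r ≤ (-fun x => f x - ∫ z, f z ∂stdGaussian E) x} := fun x hx => by
    simpa [le_abs] using hx
  refine (measureReal_mono hsub).trans ((measureReal_union_le _ _).trans ?_)
  push_cast at h1 h2
  linarith

end Concentration

/-! ### Full support and independent standard Gaussian vectors -/

instance isOpenPosMeasure_stdGaussian {E : Type*} [NormedAddCommGroup E] [InnerProductSpace ℝ E]
    [FiniteDimensional ℝ E] [MeasurableSpace E] [BorelSpace E] :
    (stdGaussian E).IsOpenPosMeasure := by
  have : (gaussianReal 0 1).IsOpenPosMeasure :=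
    (gaussianReal_absolutelyContinuous' 0 one_ne_zero).isOpenPosMeasure
  refine Continuous.isOpenPosMeasure_map (by fun_prop) fun v => ?_
  exact ⟨fun i => (stdOrthonormalBasis ℝ E).repr v i, (stdOrthonormalBasis ℝ E).sum_repr v⟩

/-- Independent standard Gaussian vectors form a standard Gaussian vector of the `ℓ²` sum. -/
lemma map_toLp_eq_stdGaussian {ι Ω F : Type*} [Fintype ι] [MeasurableSpace Ω] {P : Measure Ω}
    [IsProbabilityMeasure P] [NormedAddCommGroup F] [InnerProductSpace ℝ F]
    [FiniteDimensional ℝ F] [MeasurableSpace F] [BorelSpace F] {X : ι → Ω → F}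
    (hX : ∀ i, HasLaw (X i) (stdGaussian F) P) (hind : iIndepFun X P) :
    P.map (fun ω => WithLp.toLp 2 (X · ω)) = stdGaussian (PiLp 2 fun _ : ι => F) := by
  have hm : ∀ i, AEMeasurable (X i) P := fun i => (hX i).aemeasurable
  have : IsProbabilityMeasure (P.map (fun ω => WithLp.toLp 2 (X · ω))) :=
    Measure.isProbabilityMeasure_map (by fun_prop)
  apply Measure.ext_of_charFun
  ext t
  rw [(iIndepFun_iff_charFun_pi hm).1 hind t, charFun_stdGaussian]
  simp_rw [(hX _).map_eq, charFun_stdGaussian, ← Complex.exp_sum]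
  rw [← Complex.ofReal_pow, PiLp.norm_sq_eq_of_L2]
  push_cast
  rw [← Finset.sum_neg_distrib, Finset.sum_div]

/-! ### The largest singular value is the operator norm -/

lemma LinearMap.singularValues_zero_eq_opNorm {E F : Type*} [NormedAddCommGroup E]
    [InnerProductSpace ℝ E] [FiniteDimensional ℝ E] [NormedAddCommGroup F] [InnerProductSpace ℝ F]
    [FiniteDimensional ℝ F] (T : E →ₗ[ℝ] F) :
    T.singularValues 0 = ‖LinearMap.toContinuousLinearMap T‖ := by
  have hsq : ∀ x, ‖T x‖ ^ 2 = inner ℝ x ((LinearMap.adjoint T ∘ₗ T) x) := fun x => by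
    rw [LinearMap.comp_apply, LinearMap.adjoint_inner_right, real_inner_self_eq_norm_sq]
  have hs0 := T.singularValues_nonneg 0
  apply le_antisymm
  · rcases Nat.eq_zero_or_pos (Module.finrank ℝ E) with h0 | hpos
    · rw [T.singularValues_of_finrank_le h0.le]
      exact norm_nonneg _
    · obtain ⟨v, hv⟩ :=
        (T.hasEigenvalue_adjoint_comp_self_sq_singularValues hpos).exists_hasEigenvector
      have hv0 : 0 < ‖v‖ := norm_pos_iff.2 hv.2
      have h1 : ‖T v‖ ^ 2 = (T.singularValues 0 * ‖v‖) ^ 2 := by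
        rw [hsq, hv.apply_eq_smul, inner_smul_right, real_inner_self_eq_norm_sq]
        simp [mul_pow]
      have h2 : ‖T v‖ = T.singularValues 0 * ‖v‖ :=
        (pow_left_inj₀ (norm_nonneg _) (by positivity) two_ne_zero).1 h1
      have h3 := (LinearMap.toContinuousLinearMap T).le_opNorm v
      rw [LinearMap.coe_toContinuousLinearMap', h2] at h3
      exact le_of_mul_le_mul_right h3 hv0
  · refine ContinuousLinearMap.opNorm_le_bound _ hs0 fun x => ?_
    rw [LinearMap.coe_toContinuousLinearMap']
    refine (pow_le_pow_iff_left₀ (norm_nonneg _) (by positivity) two_ne_zero).1 ?_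
    set hS := T.isSymmetric_adjoint_comp_self
    set b := hS.eigenvectorBasis rfl
    rw [hsq, ← b.sum_inner_mul_inner, mul_pow, ← b.sum_sq_inner_right, Finset.mul_sum]
    refine Finset.sum_le_sum fun i _ => ?_
    have h1 : inner ℝ (b i) ((LinearMap.adjoint T ∘ₗ T) x) =
        T.singularValues i ^ 2 * inner ℝ (b i) x := by
      rw [← hS (b i) x, hS.apply_eigenvectorBasis rfl i, T.sq_singularValues_fin rfl i]
      simp [inner_smul_left, b]
    rw [h1, real_inner_comm]
    have h2 : T.singularValues i ^ 2 ≤ T.singularValues 0 ^ 2 :=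
      pow_le_pow_left₀ (T.singularValues_nonneg i) (T.singularValues_antitone (Nat.zero_le i)) 2
    nlinarith [sq_nonneg (inner ℝ (b i) x)]

lemma norm_toEuclideanLin_apply_le {m k : ℕ} (M : Matrix (Fin m) (Fin k) ℝ)
    (x : EuclideanSpace ℝ (Fin k)) :
    ‖Matrix.toEuclideanLin M x‖ ≤ √(∑ i, ∑ j, |M j i| ^ 2) * ‖x‖ := by
  refine (pow_le_pow_iff_left₀ (norm_nonneg _) (by positivity) two_ne_zero).1 ?_
  rw [mul_pow, Real.sq_sqrt (by positivity), EuclideanSpace.real_norm_sq_eq,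
    EuclideanSpace.real_norm_sq_eq, Finset.sum_comm, Finset.sum_mul]
  refine Finset.sum_le_sum fun j _ => ?_
  simp only [sq_abs]
  simpa [Matrix.toLpLin_apply, Matrix.mulVec, dotProduct] using
    Finset.sum_mul_sq_le_sq_mul_sq Finset.univ (fun i => M j i) fun i => x i

/-- The largest singular value is `1`-Lipschitz for the Frobenius norm. -/
lemma abs_sigmaOne_sub_le {m k : ℕ} (M M' : Matrix (Fin m) (Fin k) ℝ) :
    |sigmaOne M - sigmaOne M'| ≤ √(∑ i, ∑ j, |(M - M') j i| ^ 2) := by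
  rw [sigmaOne, sigmaOne, LinearMap.singularValues_zero_eq_opNorm,
    LinearMap.singularValues_zero_eq_opNorm]
  refine (abs_norm_sub_norm_le _ _).trans ?_
  rw [← map_sub, ← map_sub]
  exact ContinuousLinearMap.opNorm_le_bound _ (Real.sqrt_nonneg _) fun x =>
    norm_toEuclideanLin_apply_le _ x

/-! ### Dependence of the data matrix on the noise -/

section DataMatrix

variable {n N : ℕ} (A : Matrix (Fin n) (Fin n) ℝ)

lemma state_sub (v w : Fin N → EuclideanSpace ℝ (Fin n)) (t : ℕ) :
    state A (fun i => v i - w i) t = state A v t - state A w t := by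
  induction t with
  | zero => simp [state]
  | succ t ih =>
    simp only [state, ih, map_sub]
    split_ifs <;> abel

lemma dataMatrix_sub (v w : Fin N → EuclideanSpace ℝ (Fin n)) :
    dataMatrix A (fun i => v i - w i) = dataMatrix A v - dataMatrix A w := by
  ext j i
  simp [dataMatrix, state_sub]

lemma continuous_state (t : ℕ) :
    Continuous fun E : NoiseSpace n N => state A (fun i => E i) t := by
  induction t with
  | zero => exact continuous_const
  | succ t ih =>
    refine ((Matrix.toEuclideanLin A).continuous_of_finiteDimensional.comp ih).add ?_
    split_ifs with h
    · fun_prop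
    · exact continuous_const

lemma continuous_dataMatrix_apply (j : Fin n) (i : Fin N) :
    Continuous fun E : NoiseSpace n N => dataMatrix A (fun t => E t) j i := by
  have := continuous_state (N := N) A i
  simp only [dataMatrix, Matrix.of_apply]
  fun_prop

lemma norm_sq_noiseSpace (E : NoiseSpace n N) : ‖E‖ ^ 2 = ∑ i, ∑ j, |E i j| ^ 2 := by
  rw [PiLp.norm_sq_eq_of_L2]
  simp [EuclideanSpace.real_norm_sq_eq]

/-- A Frobenius bound for the data matrix of every noise matrix makes `σ₁` of the data matrix a
Lipschitz function of the noise. -/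
lemma lipschitzWith_sigmaOne_dataMatrix {L : ℝ≥0}
    (h : ∀ E : NoiseSpace n N, ∑ i, ∑ j, |dataMatrix A (fun t => E t) j i| ^ 2 ≤
      (L : ℝ) ^ 2 * ‖E‖ ^ 2) :
    LipschitzWith L fun E : NoiseSpace n N => sigmaOne (dataMatrix A fun t => E t) := by
  refine LipschitzWith.of_dist_le_mul fun v w => ?_
  rw [Real.dist_eq, dist_eq_norm]
  refine (abs_sigmaOne_sub_le _ _).trans (Real.sqrt_le_iff.2 ⟨by positivity, ?_⟩)
  rw [← dataMatrix_sub, mul_pow]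
  exact h (v - w)

end DataMatrix

/-! ### Concentration of the largest singular value -/

theorem mainTheorem12 {n N : ℕ} (A : Matrix (Fin n) (Fin n) ℝ)
    {Ω : Type*} [MeasurableSpace Ω] (P : Measure Ω) [IsProbabilityMeasure P]
    (w : Fin N → Ω → EuclideanSpace ℝ (Fin n))
    (hlaw : ∀ t, HasLaw (w t) (multivariateGaussian 0 1) P)
    (hindep : iIndepFun w P)
    (L : ℝ≥0) (hL : 0 < L)
    (hX : ∀ᵐ ω ∂P,
      ∑ i : Fin N, ∑ j : Fin n, |dataMatrix A (fun t => w t ω) j i| ^ 2 ≤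
        (L : ℝ) ^ 2 * ∑ i : Fin N, ∑ j : Fin n, |w i ω j| ^ 2) :
    LipschitzWith L (fun E : NoiseSpace n N => sigmaOne (dataMatrix A (fun t => E t))) ∧
    Integrable (fun ω => sigmaOne (dataMatrix A (fun t => w t ω))) P ∧
    ∀ δ : ℝ, 0 < δ → δ < 1 →
      P.real {ω | √2 * δ * (L : ℝ) ≤
          |sigmaOne (dataMatrix A (fun t => w t ω)) -
            ∫ ω', sigmaOne (dataMatrix A (fun t => w t ω')) ∂P|} ≤
        2 * Real.exp (-δ ^ 2) := by
  have hmeas : ∀ t, AEMeasurable (w t) P := fun t => (hlaw t).aemeasurable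
  set W : Ω → NoiseSpace n N := fun ω => WithLp.toLp 2 (w · ω) with hW
  have hWm : AEMeasurable W P := by fun_prop
  have hWlaw : P.map W = stdGaussian (NoiseSpace n N) :=
    map_toLp_eq_stdGaussian (fun t => by simpa using hlaw t) hindep
  have hcl : IsClosed {E : NoiseSpace n N | ∑ i, ∑ j, |dataMatrix A (fun t => E t) j i| ^ 2 ≤
      (L : ℝ) ^ 2 * ‖E‖ ^ 2} := by
    have hc := continuous_dataMatrix_apply (N := N) A
    exact isClosed_le (by fun_prop) (by fun_prop)
  -- the Gaussian measure charges every nonempty open set, so that a closed condition that holds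
  -- almost surely holds for every noise matrix
  have hall : ∀ E : NoiseSpace n N, ∑ i, ∑ j, |dataMatrix A (fun t => E t) j i| ^ 2 ≤
      (L : ℝ) ^ 2 * ‖E‖ ^ 2 := by
    have hae : ∀ᵐ E ∂stdGaussian (NoiseSpace n N),
        ∑ i, ∑ j, |dataMatrix A (fun t => E t) j i| ^ 2 ≤ (L : ℝ) ^ 2 * ‖E‖ ^ 2 := by
      rw [← hWlaw, ae_map_iff hWm hcl.measurableSet]
      filter_upwards [hX] with ω hω
      rw [norm_sq_noiseSpace]
      exact hω
    have hd := (MeasureTheory.Measure.dense_of_ae hae).closure_eq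
    rw [hcl.closure_eq] at hd
    exact fun E => hd.symm.subset (Set.mem_univ E)
  have hlip := lipschitzWith_sigmaOne_dataMatrix A hall
  set f : NoiseSpace n N → ℝ := fun E => sigmaOne (dataMatrix A fun t => E t) with hf
  have hfm : Measurable f := hlip.continuous.measurable
  have hint : Integrable (f ∘ W) P := by
    rw [← integrable_map_measure hfm.aestronglyMeasurable hWm, hWlaw]
    exact hlip.integrable_stdGaussian
  refine ⟨hlip, hint, fun δ hδ _ => ?_⟩
  have hmean : ∫ ω, f (W ω) ∂P = ∫ E, f E ∂stdGaussian (NoiseSpace n N) := by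
    rw [← hWlaw, integral_map hWm hfm.aestronglyMeasurable]
  have htail := hlip.measure_abs_sub_integral_ge_le_stdGaussian (r := √2 * δ * L) (by positivity)
  rw [← hmean, ← hWlaw, map_measureReal_apply_of_aemeasurable hWm
    (measurableSet_le measurable_const (by fun_prop))] at htail
  refine htail.trans_eq ?_
  have hL' : (L : ℝ) ≠ 0 := by exact_mod_cast hL.ne'
  rw [mul_pow, mul_pow, Real.sq_sqrt two_pos.le]
  congr 2
  field_simp
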